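/- Let $\mathcal A$ and $\mathcal B$ be von Neumann algebras acting on complex Hilbert spaces $K$ and $H$ respectively, and suppose that there is a $*$-isomorphism $\pi:\mathcal A'\to\mathcal B'$ between their commutants. For a linear space $\mathcal U\subset B(H_1,H_2)$ of bounded operators between Hilbert spaces and $T\in B(H_1,H_2)$ put $d(T,\mathcal U)=\inf_{X\in\mathcal U}\|T-X\|$ and $$r_{\mathcal U}(T)=\sup\{|\langle T\xi,\eta\rangle| : \|\xi\|=\|\eta\|=1,\ \langle X\xi,\eta\rangle=0\ \text{for all } X\in\mathcal U\},$$ and let $k(\mathcal U)=\sup_{T\notin\mathcal U} d(T,\mathcal U)/r_{\mathcal U}(T)\in[0,\infty]$ be the hyperreflexivity constant of $\mathcal U$ (here $\sup\emptyset=0$, and $c/0=\infty$ for $c>0$). For a cardinal $I$ let $M_I^w(\mathcal U)$ be the space of $I\times I$ matrices with entries in $\mathcal U$ whose finite submatrices have uniformly bounded norm, regarded as a space of bounded operators from the Hilbert direct sum $H_1^I$ to $H_2^I$. If $I$ is an infinite cardinal greater than or equal to the cardinality of an orthonormal basis of $H$, then $$k(M_I^w(\mathcal B))\le k(M_I^w(\mathcal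 A)).$$ If, moreover, $H$ and $K$ are both separable, then $k(M_{\aleph_0}^w(\mathcal B))=k(M_{\aleph_0}^w(\mathcal A))$, that is, $\mathcal A$ and $\mathcal B$ have the same complete hyperreflexivity constant. -/

import Mathlib

open scoped ENNReal

universe u v w x

noncomputable section

namespace Hyperreflexivity

/-- The Hilbert space `H^I`, the Hilbert direct sum of `I` copies of `H`. -/
abbrev Ampl (I : Type*) (H : Type*) [NormedAddCommGroup H] : Type _ :=
  lp (fun _ : I => H) 2

section Constant

variable {H K : Type*} [NormedAddCommGroup H] [InnerProductSpace ℂ H]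
  [NormedAddCommGroup K] [InnerProductSpace ℂ K]

/-- The operator-norm distance `d(T, U) = inf {‖T - X‖ : X ∈ U}`. It is always finite, as `0 ∈ U`. -/
def dist (U : Submodule ℂ (H →L[ℂ] K)) (T : H →L[ℂ] K) : ℝ≥0∞ :=
  ⨅ X ∈ U, ‖T - X‖ₑ

/-- `r_U(T)`, the supremum of `|⟨T ξ, η⟩|` over all unit vectors `ξ ∈ H`, `η ∈ K` with
`⟨X ξ, η⟩ = 0` for every `X ∈ U` (the supremum is `0` if there are no such pairs). -/
def rad (U : Submodule ℂ (H →L[ℂ] K)) (T : H →L[ℂ] K) : ℝ≥0∞ :=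
  ⨆ (ξ : H) (η : K) (_ : ‖ξ‖ = 1) (_ : ‖η‖ = 1) (_ : ∀ X ∈ U, inner ℂ (X ξ) η = 0),
    ‖inner ℂ (T ξ) η‖ₑ

/-- The hyperreflexivity constant `k(U) = sup {d(T, U) / r_U(T) : T ∉ U}` in `[0, ∞]`.
For `U` norm closed and `T ∉ U` the numerator is nonzero and finite, so a vanishing `r_U(T)`
gives the quotient `∞`. The supremum over the empty set (`U` all of `B(H, K)`) is `0`. -/
def hyperConst (U : Submodule ℂ (H →L[ℂ] K)) : ℝ≥0∞ :=
  ⨆ (T : H →L[ℂ] K) (_ : T ∉ U), dist U T / rad U T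

open scoped Classical in
/-- The `(i, j)` entry of an operator `H^I → K^I`, regarded as an `I × I` operator matrix:
embed `H` as the `j`-th summand, apply the operator, take the `i`-th coordinate. -/
def entry {I : Type*} (T : Ampl I H →L[ℂ] Ampl I K) (i j : I) : H →L[ℂ] K :=
  (lp.evalCLM ℂ (fun _ : I => K) 2 i) ∘L T ∘L
    (lp.singleContinuousLinearMap ℂ (fun _ : I => H) 2 j)

/-- `M_I^w(U)`: the `I × I` matrices with entries in `U` whose finite submatrices are uniformly
bounded in norm, i.e. the matrices with entries in `U` of bounded operators `H^I → K^I`,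
as a space of operators `H^I → K^I`. -/
def matrixSpace (I : Type*) (U : Submodule ℂ (H →L[ℂ] K)) :
    Submodule ℂ (Ampl I H →L[ℂ] Ampl I K) where
  carrier := {T | ∀ i j, entry T i j ∈ U}
  add_mem' {S T} hS hT i j := by
    have h : entry (S + T) i j = entry S i j + entry T i j := by
      ext x; simp [entry]
    rw [h]; exact U.add_mem (hS i j) (hT i j)
  zero_mem' i j := by
    have h : entry (0 : Ampl I H →L[ℂ] Ampl I K) i j = 0 := by
      ext x; simp [entry]
    rw [h]; exact U.zero_mem
  smul_mem' c T hT i j := by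
    have h : entry (c • T) i j = c • entry T i j := by
      ext x; simp [entry]
    rw [h]; exact U.smul_mem c (hT i j)

end Constant

/-- The underlying linear space of operators of a von Neumann algebra. -/
def opSpace {H : Type*} [NormedAddCommGroup H] [InnerProductSpace ℂ H] [CompleteSpace H]
    (A : VonNeumannAlgebra H) : Submodule ℂ (H →L[ℂ] H) :=
  Subalgebra.toSubmodule A.toStarSubalgebra.toSubalgebra

end Hyperreflexivity

end

/-! The space $M_I^w(\mathcal B)$ is the commutant of the amplification of $\mathcal B'$ to $H^I$
(`mem_matrixSpace_iff`). So it suffices to find an isometry $W:H^I\to K^I$ intertwining the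
amplifications of $\pi(b)$ and $b$ for $b\in\mathcal A'$. Then $T\mapsto WTW^*$ and $X\mapsto W^*XW$
exchange the two matrix spaces, $M_I^w(\mathcal B)$ is a corner of $M_I^w(\mathcal A)$, and $k$ does
not increase under passing to a corner (`hyperConst_le_of_corner`).

To build $W$, split $H$ into orthogonal cyclic subspaces for $\pi(\mathcal A')$ whose cyclic vectors
$x$ satisfy $\|\pi(b)x\|=\|b\eta_x\|$ for some $\eta_x\in K$ (`exists_cyclic_decomposition`). There
are few enough of them to inject $I\times X$ into $I$, and sending $\pi(b)x$ in copy $i$ to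
$b\eta_x$ in copy $\varphi(i,x)$ preserves Gram matrices.

The heart is to cut any $\xi\ne0$ down to such a vector (`exists_cutdown`). Below the support of
$\xi$, a Zorn argument yields a nonzero projection $p$ under which a longer vector $\eta$ dominates
$\xi$ on all projections (`exists_dominating_projection`). Dyadic expansion carries this to positive
elements, and a Radon–Nikodym argument in the commutant replaces $\eta$ by a vector giving equality.
Only order properties of $\pi$ enter; its normality is never invoked. -/

namespace Hyperreflexivity
-- Projections in a von Neumann algebra
section Projections

variable {K : Type*} [NormedAddCommGroup K] [InnerProductSpace ℂ K] [CompleteSpace K]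

/-- The projection onto a closed subspace invariant under the commutant lies in the algebra. -/
theorem starProjection_mem (M : VonNeumannAlgebra K) (U : Submodule ℂ K)
    [U.HasOrthogonalProjection] (hU : ∀ y ∈ M.commutant, ∀ k ∈ U, y k ∈ U) :
    U.starProjection ∈ M := by
  rw [VonNeumannAlgebra.IsStarProjection.mem_iff isStarProjection_starProjection]
  intro y hy
  rw [Submodule.range_starProjection]
  exact fun k hk => hU y hy k hk

theorem mem_of_commute (M : VonNeumannAlgebra K) {x : K →L[ℂ] K}
    (h : ∀ y ∈ M.commutant, Commute x y) : x ∈ M := by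
  rw [← VonNeumannAlgebra.commutant_commutant M, VonNeumannAlgebra.mem_commutant_iff]
  exact fun g hg => (h g hg).symm

theorem commute_of_mem {M : VonNeumannAlgebra K} {x y : K →L[ℂ] K} (hx : x ∈ M)
    (hy : y ∈ M.commutant) : Commute x y :=
  VonNeumannAlgebra.mem_commutant_iff.1 hy x hx

omit [CompleteSpace K] in
/-- A map that preserves a set preserves its closed linear span. -/
theorem map_mem_closure_span {S : Set K} (y : K →L[ℂ] K) (h : ∀ k ∈ S, y k ∈ S) {k : K}
    (hk : k ∈ (Submodule.span ℂ S).topologicalClosure) :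
    y k ∈ (Submodule.span ℂ S).topologicalClosure := by
  have h1 : Set.MapsTo y (Submodule.span ℂ S : Set K) (Submodule.span ℂ S : Set K) := by
    intro z hz
    induction hz using Submodule.span_induction with
    | mem z hz => exact Submodule.subset_span (h z hz)
    | zero => simp
    | add a b _ _ ha hb => rw [map_add]; exact Submodule.add_mem _ ha hb
    | smul c a _ ha => rw [map_smul]; exact Submodule.smul_mem _ c ha
  exact h1.closure y.continuous hk

/-- Every nonempty chain of projections of a von Neumann algebra has a least upper bound among
the projections, and it is the strong limit of the chain. -/
theorem exists_lub_projection (M : VonNeumannAlgebra K) (C : Set (K →L[ℂ] K))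
    (hC : ∀ c ∈ C, c ∈ M ∧ IsStarProjection c) (hch : IsChain (· ≤ ·) C) (hne : C.Nonempty) :
    ∃ E ∈ M, IsStarProjection E ∧ (∀ c ∈ C, c ≤ E) ∧
      (∀ s, IsStarProjection s → (∀ c ∈ C, c ≤ s) → E ≤ s) ∧
      ∀ η : K, ∀ ε > 0, ∃ c ∈ C, ‖E η‖ ≤ ‖c η‖ + ε := by
  classical
  set S : Submodule ℂ K := ⨆ c : C, LinearMap.range (c : K →L[ℂ] K).toLinearMap with hS
  have hdir : Directed (· ≤ ·) fun c : C => LinearMap.range (c : K →L[ℂ] K).toLinearMap := by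
    have key : ∀ c ∈ C, ∀ d ∈ C, c ≤ d →
        LinearMap.range (c : K →L[ℂ] K).toLinearMap ≤ LinearMap.range (d : K →L[ℂ] K).toLinearMap := by
      rintro c hc d hd hcd _ ⟨k, rfl⟩
      have := (IsStarProjection.le_iff_mul_eq_right (hC c hc).2 (hC d hd).2).1 hcd
      exact ⟨c k, by simpa using congr($this k)⟩
    intro c d
    rcases hch.total c.2 d.2 with h | h
    · exact ⟨d, key _ c.2 _ d.2 h, le_rfl⟩
    · exact ⟨c, le_rfl, key _ d.2 _ c.2 h⟩
  have : Nonempty C := hne.to_subtype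
  -- The ranges are directed, so their union is already a subspace, and each of its vectors is fixed
  -- by a single member of the chain.
  have hmem : ∀ {z}, z ∈ S ↔ ∃ c ∈ C, c z = z := by
    intro z
    rw [hS, Submodule.mem_iSup_of_directed _ hdir]
    constructor
    · rintro ⟨c, k, rfl⟩
      exact ⟨c, c.2, by simpa using congr($((hC c c.2).2.isIdempotentElem.eq) k)⟩
    · rintro ⟨c, hc, h⟩
      exact ⟨⟨c, hc⟩, z, h⟩
  have hcS : ∀ c ∈ C, ∀ k, c k ∈ S.topologicalClosure := fun c hc k =>
    S.le_topologicalClosure (hmem.2 ⟨c, hc, by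
      simpa using congr($((hC c hc).2.isIdempotentElem.eq) k)⟩)
  have hE := isStarProjection_starProjection (U := S.topologicalClosure)
  refine ⟨S.topologicalClosure.starProjection, ?_, hE, ?_, ?_, ?_⟩
  · refine starProjection_mem M _ fun y hy k hk => ?_
    have : Set.MapsTo y (S : Set K) (S : Set K) := by
      intro z hz
      obtain ⟨c, hc, h⟩ := hmem.1 hz
      refine hmem.2 ⟨c, hc, ?_⟩
      have := congr($((commute_of_mem (hC c hc).1 hy).eq) z)
      simpa [h] using this
    exact this.closure y.continuous hk
  · intro c hc
    refine (IsStarProjection.le_iff_mul_eq_right (hC c hc).2 hE).2 ?_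
    ext k
    exact Submodule.starProjection_eq_self_iff.2 (hcS c hc k)
  · intro s hs hcs
    refine (IsStarProjection.le_iff_mul_eq_right hE hs).2 ?_
    ext k
    have : ∀ z ∈ S.topologicalClosure, s z = z := by
      intro z hz
      refine closure_minimal (s := (S : Set K)) (t := {z | s z = z}) ?_
        (isClosed_eq s.continuous continuous_id) hz
      intro z hz
      obtain ⟨c, hc, h⟩ := hmem.1 hz
      have := (IsStarProjection.le_iff_mul_eq_right (hC c hc).2 hs).1 (hcs c hc)
      simpa [h] using congr($this z)
    exact this _ (Submodule.starProjection_apply_mem _ _)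
  · intro η ε hε
    set E := S.topologicalClosure.starProjection
    have h1 : E η ∈ closure (S : Set K) :=
      Submodule.starProjection_apply_mem S.topologicalClosure η
    obtain ⟨ζ, hζ, hd⟩ := Metric.mem_closure_iff.1 h1 ε hε
    obtain ⟨c, hc, h⟩ := hmem.1 hζ
    refine ⟨c, hc, ?_⟩
    have hcE : c (E η) = c η := by
      have := (IsStarProjection.le_iff_mul_eq_left (hC c hc).2 hE).1
        ((IsStarProjection.le_iff_mul_eq_right (hC c hc).2 hE).2 (by
          ext k; exact Submodule.starProjection_eq_self_iff.2 (hcS c hc k)))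
      exact congr($this η)
    -- The approximant `ζ` is fixed by `c`, so `1 - c` kills it and the error is at most the
    -- distance from `E η` to `ζ`.
    have h2 : E η - c η = (1 - c) (E η - ζ) := by
      simp [hcE, h]
    have h3 : ‖E η - c η‖ ≤ ε := by
      rw [h2]
      calc _ ≤ ‖1 - c‖ * ‖E η - ζ‖ := ContinuousLinearMap.le_opNorm _ _
        _ ≤ 1 * ‖E η - ζ‖ := by
          gcongr
          exact IsStarProjection.norm_le _ (hC c hc).2.one_sub
        _ ≤ ε := by rw [one_mul, ← dist_eq_norm]; exact hd.le
    calc ‖E η‖ = ‖c η + (E η - c η)‖ := by congr 1; abel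
      _ ≤ _ := (norm_add_le _ _).trans (by gcongr)

/-- The range projection of an element of a von Neumann algebra. -/
theorem exists_range_projection (M : VonNeumannAlgebra K) {X : K →L[ℂ] K} (hX : X ∈ M) :
    ∃ e ∈ M, IsStarProjection e ∧ e * X = X ∧ ∀ Z : K →L[ℂ] K, Z * X = 0 → Z * e = 0 := by
  set S : Submodule ℂ K := LinearMap.range X.toLinearMap
  refine ⟨S.topologicalClosure.starProjection, ?_, isStarProjection_starProjection, ?_, ?_⟩
  · refine starProjection_mem M _ fun y hy k hk => ?_
    have : Set.MapsTo y (S : Set K) (S : Set K) := by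
      rintro _ ⟨z, rfl⟩
      exact ⟨y z, congr($((commute_of_mem hX hy).eq) z)⟩
    exact this.closure y.continuous hk
  · ext k
    exact Submodule.starProjection_eq_self_iff.2 (S.le_topologicalClosure ⟨k, rfl⟩)
  · intro Z hZ
    ext k
    refine closure_minimal (s := (S : Set K)) (t := {z | Z z = 0}) ?_
        (isClosed_eq Z.continuous continuous_const) (Submodule.starProjection_apply_mem
          S.topologicalClosure k)
    rintro _ ⟨z, rfl⟩
    exact congr($hZ z)

/-- Real functional calculus does not leave a von Neumann algebra. -/
theorem cfcₙ_mem (M : VonNeumannAlgebra K) {x : K →L[ℂ] K} (hx : x ∈ M) (f : ℝ → ℝ) :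
    cfcₙ f x ∈ M :=
  mem_of_commute M fun _ hy => (commute_of_mem hx hy).cfcₙ_real f

theorem sqrt_mem (M : VonNeumannAlgebra K) {x : K →L[ℂ] K} (hx : x ∈ M) :
    CFC.sqrt x ∈ M :=
  mem_of_commute M fun _ hy => (commute_of_mem hx hy).cfcₙ_nnreal _

/-- One step of the dyadic expansion of a positive operator into projections. -/
theorem exists_dyadic_projection (M : VonNeumannAlgebra K) {a p : K →L[ℂ] K} (ha : a ∈ M)
    (hp : p ∈ M) (hpp : IsStarProjection p) (ha0 : 0 ≤ a) (hap : a ≤ p) :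
    ∃ e ∈ M, IsStarProjection e ∧ e ≤ p ∧ 0 ≤ (2 : ℂ) • a - e ∧ (2 : ℂ) • a - e ≤ p := by
  obtain ⟨hap1, hap2⟩ := IsStarProjection.mul_right_and_mul_left_of_nonneg_of_le hpp ha0 hap
  set x := a + a - p with hxdef
  have hasa : IsSelfAdjoint a := IsSelfAdjoint.of_nonneg ha0
  have hx : IsSelfAdjoint x := (hasa.add hasa).sub hpp.isSelfAdjoint
  have hxM : x ∈ M := sub_mem (add_mem ha ha) hp
  set X := x⁺ with hXdef
  set Y := x⁻ with hYdef
  have hXM : X ∈ M := cfcₙ_mem M hxM _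
  have hXY : X - Y = x := CFC.posPart_sub_negPart x hx
  have hXYm : X * Y = 0 := CFC.posPart_mul_negPart x
  have hYXm : Y * X = 0 := CFC.negPart_mul_posPart x
  have hX0 : 0 ≤ X := CFC.posPart_nonneg x
  have hY0 : 0 ≤ Y := CFC.negPart_nonneg x
  have hXs : star X = X := (IsSelfAdjoint.of_nonneg hX0).star_eq
  have hYs : star Y = Y := (IsSelfAdjoint.of_nonneg hY0).star_eq
  have hps : star p = p := hpp.isSelfAdjoint.star_eq
  have hpi : p * p = p := hpp.isIdempotentElem.eq
  have hXp : X * p = X := by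
    have h1 : X * X = X * x := by rw [← hXY, mul_sub, hXYm, sub_zero]
    have h2 : X * X * (1 - p) = 0 := by
      rw [h1, mul_assoc]
      have : x * (1 - p) = 0 := by
        rw [hxdef]; simp only [mul_sub, sub_mul, add_mul, hap1, hpi, mul_one]; abel
      rw [this, mul_zero]
    have h3 : star (X * (1 - p)) * (X * (1 - p)) = 0 := by
      rw [star_mul, hXs, mul_assoc, ← mul_assoc X, h2, mul_zero]
    have h4 := CStarRing.star_mul_self_eq_zero_iff _ |>.1 h3
    rw [mul_sub, mul_one, sub_eq_zero] at h4
    exact h4.symm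
  have hpX : p * X = X := by simpa [hXs, hps] using congr(star $hXp)
  -- The next binary digit of `a`: the range projection of the positive part of `2a - p`. It reduces
  -- `2a`, with `2a - e = (p - e)(2a)(p - e) + X` and `p - (2a - e) = e(2(p - a))e + Y`, both
  -- visibly positive.
  obtain ⟨e, heM, he, heX, hez⟩ := exists_range_projection M hXM
  have hes : star e = e := he.isSelfAdjoint.star_eq
  have hei : e * e = e := he.isIdempotentElem.eq
  have hXe : X * e = X := by simpa [hXs, hes] using congr(star $heX)
  have hYe : Y * e = 0 := hez Y hYXm
  have heY : e * Y = 0 := by simpa [hYs, hes] using congr(star $hYe)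
  have hpe : p * e = e := by
    have := hez (1 - p) (by rw [sub_mul, one_mul, hpX, sub_self])
    rw [sub_mul, one_mul, sub_eq_zero] at this
    exact this.symm
  have hep : e * p = e := by simpa [hps, hes] using congr(star $hpe)
  have hYdef' : Y = X - (a + a - p) := by rw [← hxdef, ← hXY]; abel
  have hea : e * (a + a) = X + e := by
    have : e * Y = e * X - (e * (a + a) - e * p) := by rw [hYdef']; simp only [mul_sub]
    rw [heY, heX, hep] at this
    have h' : e * (a + a) = X + e - 0 := by rw [this]; abel
    simpa using h'
  have hae : (a + a) * e = X + e := by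
    have := congr(star $hea)
    rwa [star_mul, star_add, star_add, hasa.star_eq, hXs, hes] at this
  have h2a : (2 : ℂ) • a = a + a := two_smul ℂ a
  refine ⟨e, heM, he, (IsStarProjection.le_iff_mul_eq_right he hpp).2 hpe, ?_, ?_⟩
  · have h0 : 0 ≤ (p - e) * (a + a) * (p - e) :=
      IsSelfAdjoint.conjugate_nonneg (add_nonneg ha0 ha0)
        (hpp.isSelfAdjoint.sub he.isSelfAdjoint)
    have : (2 : ℂ) • a - e = (p - e) * (a + a) * (p - e) + X := by
      have e1 : (p - e) * (a + a) = a + a - (X + e) := by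
        rw [sub_mul, hea, mul_add, hap2]
      rw [e1, h2a]
      simp only [sub_mul, mul_sub, add_mul, hap1, hXp, hep, hXe, hei]
      rw [add_mul] at hae
      rw [hae]
      abel
    rw [this]
    exact add_nonneg h0 hX0
  · have h0 : 0 ≤ e * ((p - a) + (p - a)) * e :=
      IsSelfAdjoint.conjugate_nonneg
        (add_nonneg (sub_nonneg.2 hap) (sub_nonneg.2 hap)) he.isSelfAdjoint
    have : p - ((2 : ℂ) • a - e) = e * ((p - a) + (p - a)) * e + Y := by
      have e1 : e * ((p - a) + (p - a)) = e - X := by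
        have : e * ((p - a) + (p - a)) = e * p + e * p - e * (a + a) := by
          simp only [mul_add, mul_sub]; abel
        rw [this, hea, hep]; abel
      rw [e1, sub_mul, hei, hXe, hYdef', h2a]
      abel
    rw [← sub_nonneg, this]
    exact add_nonneg h0 hY0

end Projections
-- Comparing vector functionals on projections and positive elements
section Representations

variable {K : Type*} [NormedAddCommGroup K] [InnerProductSpace ℂ K] [CompleteSpace K]
  {H : Type*} [NormedAddCommGroup H] [InnerProductSpace ℂ H] [CompleteSpace H]
  {M : VonNeumannAlgebra K} (ρ : M.toStarSubalgebra →⋆ₐ[ℂ] (H →L[ℂ] H))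

theorem isStarProjection_map {e : M.toStarSubalgebra} (he : IsStarProjection (e : K →L[ℂ] K)) :
    IsStarProjection (ρ e) := by
  have h1 : e * e = e := Subtype.ext he.isIdempotentElem.eq
  have h2 : star e = e := Subtype.ext he.isSelfAdjoint.star_eq
  refine ⟨?_, ?_⟩
  · rw [IsIdempotentElem, ← map_mul, h1]
  · rw [IsSelfAdjoint, ← map_star, h2]

/-- A representation of a von Neumann algebra preserves positivity. -/
theorem map_nonneg_of_nonneg {a : M.toStarSubalgebra} (ha : 0 ≤ (a : K →L[ℂ] K)) : 0 ≤ ρ a := by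
  set b : M.toStarSubalgebra := ⟨CFC.sqrt (a : K →L[ℂ] K), sqrt_mem M a.2⟩
  have hb : a = star b * b := by
    apply Subtype.ext
    change (a : K →L[ℂ] K) = star (CFC.sqrt (a : K →L[ℂ] K)) * CFC.sqrt (a : K →L[ℂ] K)
    rw [(IsSelfAdjoint.of_nonneg (CFC.sqrt_nonneg _)).star_eq, CFC.sqrt_mul_sqrt_self _ ha]
  rw [hb, map_mul, map_star]
  exact star_mul_self_nonneg _

omit [CompleteSpace H] in
theorem re_inner_nonneg {T : H →L[ℂ] H} (hT : 0 ≤ T) (x : H) : 0 ≤ (inner ℂ (T x) x).re :=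
  ((ContinuousLinearMap.nonneg_iff_isPositive T).1 hT).re_inner_nonneg_left x

theorem re_inner_projection {e : H →L[ℂ] H} (he : IsStarProjection e) (x : H) :
    (inner ℂ (e x) x).re = ‖e x‖ ^ 2 := by
  have h1 : e (e x) = e x := congr($(he.isIdempotentElem.eq) x)
  have h2 : inner ℂ (e (e x)) x = inner ℂ (e x) (e x) := by
    rw [← ContinuousLinearMap.adjoint_inner_right, ← ContinuousLinearMap.star_eq_adjoint,
      he.isSelfAdjoint.star_eq]
  rw [← h1, h2, h1]
  simp [inner_self_eq_norm_sq_to_K, ← Complex.ofReal_pow]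

theorem norm_sq_add_projection {f g : H →L[ℂ] H} (hf : IsStarProjection f)
    (hg : IsStarProjection g) (hfg : IsStarProjection (f + g)) (x : H) :
    ‖(f + g) x‖ ^ 2 = ‖f x‖ ^ 2 + ‖g x‖ ^ 2 := by
  rw [← re_inner_projection hf, ← re_inner_projection hg, ← re_inner_projection hfg,
    add_apply, inner_add_left, Complex.add_re]

/-- If a vector functional dominates another one on the projections below `p`, then it does so
on the positive elements below `p`. -/
theorem vectorFunctional_le (p : M.toStarSubalgebra) (hp : IsStarProjection (p : K →L[ℂ] K))
    (ξ : H) (η : K)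
    (h : ∀ e : M.toStarSubalgebra, IsStarProjection (e : K →L[ℂ] K) →
      (e : K →L[ℂ] K) ≤ p → ‖ρ e ξ‖ ≤ ‖(e : K →L[ℂ] K) η‖)
    (a : M.toStarSubalgebra) (ha0 : 0 ≤ (a : K →L[ℂ] K)) (hap : (a : K →L[ℂ] K) ≤ p) :
    (inner ℂ (ρ a ξ) ξ).re ≤ (inner ℂ ((a : K →L[ℂ] K) η) η).re := by
  -- The crude error `‖ξ‖ ^ 2` halves at each step: write `a` as half of `e + (2a - e)`, where `e`
  -- contributes no error by hypothesis and `2a - e` again lies between `0` and `p`.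
  have key : ∀ n : ℕ, ∀ a : M.toStarSubalgebra, 0 ≤ (a : K →L[ℂ] K) → (a : K →L[ℂ] K) ≤ p →
      (inner ℂ (ρ a ξ) ξ).re - (inner ℂ ((a : K →L[ℂ] K) η) η).re ≤ ‖ξ‖ ^ 2 * (1 / 2) ^ n := by
    intro n
    induction n with
    | zero =>
      intro a ha0 hap
      have h1 := re_inner_nonneg ha0 η
      have h2 : 0 ≤ (inner ℂ (ρ (1 - a) ξ) ξ).re :=
        re_inner_nonneg (map_nonneg_of_nonneg ρ (a := 1 - a)
          (sub_nonneg.2 (hap.trans hp.le_one))) ξ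
      have h3 : (inner ℂ ξ ξ).re = ‖ξ‖ ^ 2 := by
        simp [inner_self_eq_norm_sq_to_K, ← Complex.ofReal_pow]
      rw [map_sub, map_one] at h2
      simp only [sub_apply, one_apply_eq_self, inner_sub_left,
        Complex.sub_re, h3] at h2
      simp only [pow_zero, mul_one]
      linarith
    | succ n ih =>
      intro a ha0 hap
      obtain ⟨e, heM, he, hep, hb0, hbp⟩ := exists_dyadic_projection M a.2 p.2 hp ha0 hap
      have h1 := ih ((2 : ℂ) • a - ⟨e, heM⟩) hb0 hbp
      have h2 := h ⟨e, heM⟩ he hep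
      have h3 : (inner ℂ (ρ ⟨e, heM⟩ ξ) ξ).re ≤ (inner ℂ (e η) η).re := by
        rw [re_inner_projection he, re_inner_projection (isStarProjection_map ρ (e := ⟨e, heM⟩) he)]
        gcongr
      have h4 : (inner ℂ (ρ ((2 : ℂ) • a - ⟨e, heM⟩) ξ) ξ).re =
          2 * (inner ℂ (ρ a ξ) ξ).re - (inner ℂ (ρ ⟨e, heM⟩ ξ) ξ).re := by
        rw [map_sub, map_smul, sub_apply, smul_apply,
          inner_sub_left, inner_smul_left]
        simp
      have h5 : (inner ℂ ((((2 : ℂ) • a - ⟨e, heM⟩ : M.toStarSubalgebra) : K →L[ℂ] K) η) η).re =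
          2 * (inner ℂ ((a : K →L[ℂ] K) η) η).re - (inner ℂ (e η) η).re := by
        change (inner ℂ (((2 : ℂ) • (a : K →L[ℂ] K) - e) η) η).re = _
        rw [sub_apply, smul_apply,
          inner_sub_left, inner_smul_left]
        simp
      rw [h4, h5] at h1
      rw [pow_succ (1 / 2 : ℝ)]
      linarith
  have hlim : Filter.Tendsto (fun n : ℕ => ‖ξ‖ ^ 2 * (1 / 2 : ℝ) ^ n) Filter.atTop (nhds 0) := by
    simpa using (tendsto_pow_atTop_nhds_zero_of_lt_one (r := (1 / 2 : ℝ)) (by norm_num)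
      (by norm_num)).const_mul (‖ξ‖ ^ 2)
  have := ge_of_tendsto' hlim fun n => key n a ha0 hap
  linarith

theorem re_inner_star_mul_self (b : H →L[ℂ] H) (x : H) :
    (inner ℂ ((star b * b) x) x).re = ‖b x‖ ^ 2 := by
  rw [ContinuousLinearMap.star_eq_adjoint, mul_apply_eq_comp,
    ContinuousLinearMap.adjoint_inner_left]
  simp [inner_self_eq_norm_sq_to_K, ← Complex.ofReal_pow]

/-- After scaling `b` to a contraction, `c = b p` satisfies `c* c ≤ p`, so `vectorFunctional_le`
applies to `c* c`; homogeneity removes the scaling. -/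
theorem norm_map_le_norm (p : M.toStarSubalgebra) (hp : IsStarProjection (p : K →L[ℂ] K))
    (ξ : H) (η : K)
    (h : ∀ e : M.toStarSubalgebra, IsStarProjection (e : K →L[ℂ] K) →
      (e : K →L[ℂ] K) ≤ p → ‖ρ e ξ‖ ≤ ‖(e : K →L[ℂ] K) η‖)
    (b : M.toStarSubalgebra) : ‖ρ b (ρ p ξ)‖ ≤ ‖(b : K →L[ℂ] K) ((p : K →L[ℂ] K) η)‖ := by
  obtain ⟨r, hr0, hr⟩ : ∃ r : ℝ, 0 < r ∧ ‖(r : ℂ) • (b : K →L[ℂ] K)‖ ≤ 1 := by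
    refine ⟨(‖(b : K →L[ℂ] K)‖ + 1)⁻¹, by positivity, ?_⟩
    rw [norm_smul, Complex.norm_real, Real.norm_of_nonneg (by positivity),
      inv_mul_le_iff₀ (by positivity)]
    linarith
  set c : M.toStarSubalgebra := ((r : ℂ) • b) * p with hc
  have hcp : (star c * c : M.toStarSubalgebra).1 ≤ p := by
    have h1 : star ((r : ℂ) • (b : K →L[ℂ] K)) * ((r : ℂ) • (b : K →L[ℂ] K)) ≤ 1 :=
      by
      rw [← CStarAlgebra.norm_le_one_iff_of_nonneg _ (star_mul_self_nonneg _),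
        CStarRing.norm_star_mul_self]
      exact mul_le_one₀ hr (norm_nonneg _) hr
    have h2 := star_left_conjugate_le_conjugate h1 (p : K →L[ℂ] K)
    rw [mul_one, hp.isSelfAdjoint.star_eq, hp.isIdempotentElem.eq] at h2
    refine le_of_eq_of_le ?_ h2
    change star (((r : ℂ) • (b : K →L[ℂ] K)) * p) * (((r : ℂ) • (b : K →L[ℂ] K)) * p) = _
    rw [star_mul, hp.isSelfAdjoint.star_eq]
    simp only [mul_assoc]
  have h3 := vectorFunctional_le ρ p hp ξ η h (star c * c)
    (star_mul_self_nonneg (c : K →L[ℂ] K)) hcp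
  rw [map_mul, map_star, re_inner_star_mul_self] at h3
  have h4 : (inner ℂ ((star c * c : M.toStarSubalgebra).1 η) η).re = ‖(c : K →L[ℂ] K) η‖ ^ 2 :=
    re_inner_star_mul_self (c : K →L[ℂ] K) η
  rw [h4] at h3
  have h5 := (sq_le_sq₀ (norm_nonneg _) (norm_nonneg _)).1 h3
  have h6 : ρ c ξ = (r : ℂ) • ρ b (ρ p ξ) := by
    rw [hc, map_mul, map_smul]; rfl
  have h7 : (c : K →L[ℂ] K) η = (r : ℂ) • (b : K →L[ℂ] K) ((p : K →L[ℂ] K) η) := rfl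
  rw [h6, h7, norm_smul, norm_smul] at h5
  exact le_of_mul_le_mul_left h5 (by simpa using hr0.ne')

/-- Comparison of a representation with the identity representation: below any projection `s` and
for any vector `η` of `s` longer than `ξ`, there is a nonzero projection on which `η` dominates
`ξ`. -/
theorem exists_dominating_projection (s : M.toStarSubalgebra)
    (hs : IsStarProjection (s : K →L[ℂ] K)) (ξ : H) (η : K) (hξ : ρ s ξ = ξ)
    (hη : (s : K →L[ℂ] K) η = η) (hlt : ‖ξ‖ < ‖η‖) :
    ∃ p : M.toStarSubalgebra, IsStarProjection (p : K →L[ℂ] K) ∧ (p : K →L[ℂ] K) ≤ s ∧ p ≠ 0 ∧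
      ∀ e : M.toStarSubalgebra, IsStarProjection (e : K →L[ℂ] K) →
        (e : K →L[ℂ] K) ≤ p → ‖ρ e ξ‖ ≤ ‖(e : K →L[ℂ] K) η‖ := by
  -- These are the projections with the opposite inequality. The complement in `s` of a maximal one
  -- is the desired `p`, nonzero because `s` itself violates that inequality.
  set Q : Set (K →L[ℂ] K) := {x | ∃ h : x ∈ M.toStarSubalgebra, IsStarProjection x ∧
    x ≤ (s : K →L[ℂ] K) ∧ ‖x η‖ ≤ ‖ρ ⟨x, h⟩ ξ‖} with hQ
  have h0 : (0 : K →L[ℂ] K) ∈ Q :=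
    ⟨zero_mem _, IsStarProjection.zero _, hs.nonneg, by simp⟩
  obtain ⟨q, -, hq⟩ := zorn_le_nonempty₀ Q (by
    intro C hCQ hch y hy
    obtain ⟨E, hEM, hE, hCE, hlub, happ⟩ := exists_lub_projection M C
      (fun c hc => ⟨(hCQ hc).1, (hCQ hc).2.1⟩) hch ⟨y, hy⟩
    refine ⟨E, ⟨hEM, hE, hlub s hs fun c hc => (hCQ hc).2.2.1, ?_⟩, hCE⟩
    -- Strong convergence is needed only on the `η` side; on the `ξ` side, `c ≤ E` gives `‖ρ c ξ‖ ≤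
    -- ‖ρ E ξ‖`, so `ρ` need not be normal.
    refine le_of_forall_pos_le_add fun ε hε => ?_
    obtain ⟨c, hc, hle⟩ := happ η ε hε
    obtain ⟨hcM, hcp, -, hcξ⟩ := hCQ hc
    have h1 : c * E = c := (IsStarProjection.le_iff_mul_eq_left hcp hE).1 (hCE c hc)
    have h2 : ρ ⟨c, hcM⟩ = ρ ⟨c, hcM⟩ * ρ ⟨E, hEM⟩ := by
      rw [← map_mul]; congr 1; exact Subtype.ext h1.symm
    have h3 : ‖ρ ⟨c, hcM⟩ ξ‖ ≤ ‖ρ ⟨E, hEM⟩ ξ‖ := by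
      rw [h2, mul_apply_eq_comp]
      refine (ContinuousLinearMap.le_opNorm _ _).trans ?_
      exact mul_le_of_le_one_left (norm_nonneg _)
        (IsStarProjection.norm_le _ (isStarProjection_map ρ (e := ⟨c, hcM⟩) hcp))
    linarith) 0 h0
  obtain ⟨hqM, hqp, hqs, hqξ⟩ := hq.prop
  have hmul2 : (s : K →L[ℂ] K) * q = q := (IsStarProjection.le_iff_mul_eq_right hqp hs).1 hqs
  have hps : IsStarProjection ((s : K →L[ℂ] K) - q) :=
    (IsStarProjection.le_iff_sub hqp hs).1 hqs
  refine ⟨s - ⟨q, hqM⟩, hps, sub_le_self _ hqp.nonneg, ?_, ?_⟩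
  · intro h
    have h1 : s = ⟨q, hqM⟩ := sub_eq_zero.1 h
    have h2 : (s : K →L[ℂ] K) = q := congr_arg Subtype.val h1
    rw [← h1, hξ, ← h2, hη] at hqξ
    exact absurd hqξ (not_le.2 hlt)
  · intro e he hep
    by_contra! hlt'
    have hep' : (e : K →L[ℂ] K) ≤ s - q := hep
    have h1 : e * ((s : K →L[ℂ] K) - q) = e :=
      (IsStarProjection.le_iff_mul_eq_left he hps).1 hep'
    have heq : (e : K →L[ℂ] K) * q = 0 := by
      rw [← h1, mul_assoc, sub_mul, hmul2, hqp.isIdempotentElem.eq, sub_self, mul_zero]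
    have hqe : q * (e : K →L[ℂ] K) = 0 := by
      simpa [hqp.isSelfAdjoint.star_eq, he.isSelfAdjoint.star_eq] using congr(star $heq)
    have hsum : IsStarProjection (q + e) :=
      ⟨by rw [IsIdempotentElem, mul_add, add_mul, add_mul, heq, hqe, hqp.isIdempotentElem.eq,
        he.isIdempotentElem.eq, add_zero, zero_add], hqp.isSelfAdjoint.add he.isSelfAdjoint⟩
    -- A violating `e` is orthogonal to `q`, so by Pythagoras `q + e` stays in `Q`; maximality
    -- forces `e = 0`, which violates nothing.
    have hmem : q + e ∈ Q := by
      refine ⟨add_mem hqM e.2, hsum, ?_, ?_⟩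
      · rw [← le_sub_iff_add_le']; exact hep'
      · have h2 : ρ ⟨q + e, add_mem hqM e.2⟩ = ρ ⟨q, hqM⟩ + ρ e := by rw [← map_add]; rfl
        refine (sq_le_sq₀ (norm_nonneg _) (norm_nonneg _)).1 ?_
        rw [norm_sq_add_projection hqp he hsum, h2]
        have h3 := isStarProjection_map ρ (e := ⟨q + e, add_mem hqM e.2⟩) hsum
        rw [h2] at h3
        rw [norm_sq_add_projection (isStarProjection_map ρ (e := ⟨q, hqM⟩) hqp)
          (isStarProjection_map ρ he) h3]
        gcongr
    have hle := hq.le_of_ge hmem (le_add_of_nonneg_right he.nonneg)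
    have he0 : (e : K →L[ℂ] K) = 0 := le_antisymm (by simpa using hle) he.nonneg
    have he0' : e = 0 := Subtype.ext he0
    rw [he0'] at hlt'
    simp at hlt'

end Representations
-- Cyclic vectors and vector functionals
section CyclicVectors

variable {K : Type*} [NormedAddCommGroup K] [InnerProductSpace ℂ K] [CompleteSpace K]
  {H : Type*} [NormedAddCommGroup H] [InnerProductSpace ℂ H] [CompleteSpace H]
  {M : VonNeumannAlgebra K}

/-- A vector functional of a representation that is dominated by a vector functional of the
identity representation is itself a vector functional of the identity representation. -/
theorem exists_vectorFunctional_eq (ρ : M.toStarSubalgebra →⋆ₐ[ℂ] (H →L[ℂ] H)) (ξ : H) (η : K)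
    (h : ∀ b : M.toStarSubalgebra, ‖ρ b ξ‖ ≤ ‖(b : K →L[ℂ] K) η‖) :
    ∃ η' : K, ∀ b : M.toStarSubalgebra, ‖ρ b ξ‖ = ‖(b : K →L[ℂ] K) η'‖ := by
  let e₀ : M.toStarSubalgebra →ₗ[ℂ] K :=
    { toFun := fun b => (b : K →L[ℂ] K) η
      map_add' := fun _ _ => rfl
      map_smul' := fun _ _ => rfl }
  let f : M.toStarSubalgebra →ₗ[ℂ] H :=
    { toFun := fun b => ρ b ξ
      map_add' := fun a b => by rw [map_add, add_apply]
      map_smul' := fun c b => by rw [map_smul, smul_apply]; rfl }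
  let V : Submodule ℂ K := (LinearMap.range e₀).topologicalClosure
  let e : M.toStarSubalgebra →ₗ[ℂ] V :=
    e₀.codRestrict V fun b => Submodule.le_topologicalClosure _ ⟨b, rfl⟩
  have he : DenseRange e := by
    intro z
    rw [closure_subtype]
    have hz : (z : K) ∈ closure (LinearMap.range e₀ : Set K) := z.2
    convert hz using 2
    ext y
    constructor
    · rintro ⟨_, ⟨b, rfl⟩, rfl⟩; exact ⟨b, rfl⟩
    · rintro ⟨b, rfl⟩; exact ⟨_, ⟨b, rfl⟩, rfl⟩
  let S₀ : V →L[ℂ] H := f.extendOfNorm e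
  have hS₀ : ∀ b, S₀ (e b) = f b := fun b =>
    LinearMap.extendOfNorm_eq he ⟨1, fun b => by rw [one_mul]; exact h b⟩ b
  -- `S` sends `b η` to `ρ b ξ` and vanishes on the complement of the closure of `M η`. It
  -- intertwines the two actions, so `S* S` and its square root `R` lie in the commutant; then `‖b R
  -- η‖ = ‖R b η‖ = ‖S b η‖ = ‖ρ b ξ‖`.
  obtain ⟨S, hSk⟩ : ∃ S : K →L[ℂ] H, ∀ k, S k = S₀ (V.orthogonalProjectionOnto k) :=
    ⟨S₀ ∘L V.orthogonalProjectionOnto, fun _ => rfl⟩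
  have hS : ∀ b : M.toStarSubalgebra, S ((b : K →L[ℂ] K) η) = ρ b ξ := by
    intro b
    have : V.orthogonalProjectionOnto ((b : K →L[ℂ] K) η) = e b :=
      Submodule.orthogonalProjectionOnto_mem_subspace_eq_self (e b)
    rw [hSk, this, hS₀]; rfl
  have hVinv : ∀ y ∈ M, ∀ k ∈ V, y k ∈ V := by
    intro y hy k hk
    have : Set.MapsTo y (LinearMap.range e₀ : Set K) (LinearMap.range e₀ : Set K) := by
      rintro _ ⟨z, rfl⟩
      exact ⟨⟨y, hy⟩ * z, rfl⟩
    exact this.closure y.continuous hk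
  have hP : V.starProjection ∈ M.commutant :=
    starProjection_mem _ V (by rwa [VonNeumannAlgebra.commutant_commutant])
  have hSV : ∀ k, S (V.starProjection k) = S k := by
    intro k
    rw [hSk, hSk, Submodule.starProjection_apply, Submodule.orthogonalProjectionOnto_mem_subspace_eq_self]
  have hint : ∀ b : M.toStarSubalgebra, S ∘L (b : K →L[ℂ] K) = ρ b ∘L S := by
    intro b
    ext k
    have h1 : ∀ k ∈ V, S ((b : K →L[ℂ] K) k) = ρ b (S k) := by
      intro k hk
      refine closure_minimal (s := (LinearMap.range e₀ : Set K))
        (t := {k | S ((b : K →L[ℂ] K) k) = ρ b (S k)}) ?_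
        (isClosed_eq (by fun_prop) (by fun_prop)) hk
      rintro _ ⟨c, rfl⟩
      have h2 : (b : K →L[ℂ] K) (e₀ c) = ((b * c : M.toStarSubalgebra) : K →L[ℂ] K) η := rfl
      change S ((b : K →L[ℂ] K) (e₀ c)) = ρ b (S ((c : K →L[ℂ] K) η))
      rw [h2, hS, hS, map_mul, mul_apply_eq_comp]
    have h3 : V.starProjection ((b : K →L[ℂ] K) k) = (b : K →L[ℂ] K) (V.starProjection k) :=
      congr($((commute_of_mem b.2 hP).symm.eq) k)
    change S ((b : K →L[ℂ] K) k) = ρ b (S k)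
    rw [← hSV, h3, h1 _ (Submodule.starProjection_apply_mem _ _), hSV]
  have hD : S.adjoint ∘L S ∈ M.commutant := by
    rw [VonNeumannAlgebra.mem_commutant_iff]
    intro g hg
    have h1 := hint ⟨g, hg⟩
    have h2 : g ∘L S.adjoint = S.adjoint ∘L ρ ⟨g, hg⟩ := by
      have := congr(ContinuousLinearMap.adjoint $(hint (star ⟨g, hg⟩)))
      rw [ContinuousLinearMap.adjoint_comp, ContinuousLinearMap.adjoint_comp, map_star,
        ContinuousLinearMap.star_eq_adjoint, ContinuousLinearMap.adjoint_adjoint] at this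
      rw [← this]
      congr 1
      exact (ContinuousLinearMap.adjoint_adjoint g).symm
    change g ∘L (S.adjoint ∘L S) = (S.adjoint ∘L S) ∘L g
    rw [← ContinuousLinearMap.comp_assoc, h2, ContinuousLinearMap.comp_assoc,
      ContinuousLinearMap.comp_assoc, h1]
  have hD0 : 0 ≤ S.adjoint ∘L S :=
    (ContinuousLinearMap.nonneg_iff_isPositive _).2 (ContinuousLinearMap.isPositive_adjoint_comp_self S)
  set R := CFC.sqrt (S.adjoint ∘L S) with hR
  have hRM : R ∈ M.commutant := sqrt_mem _ hD
  have hRR : star R * R = S.adjoint ∘L S := by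
    rw [(IsSelfAdjoint.of_nonneg (CFC.sqrt_nonneg _)).star_eq, CFC.sqrt_mul_sqrt_self _ hD0]
  refine ⟨R η, fun b => ?_⟩
  have h1 : (b : K →L[ℂ] K) (R η) = R ((b : K →L[ℂ] K) η) :=
    congr($((commute_of_mem b.2 hRM).eq) η)
  rw [h1, ← hS, ← sq_eq_sq₀ (norm_nonneg _) (norm_nonneg _), ← re_inner_star_mul_self R, hRR,
    ContinuousLinearMap.comp_apply, ContinuousLinearMap.adjoint_inner_left]
  simp [inner_self_eq_norm_sq_to_K, ← Complex.ofReal_pow]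

variable {N : VonNeumannAlgebra H} (π : M.toStarSubalgebra ≃⋆ₐ[ℂ] N.toStarSubalgebra)

/-- An isomorphism onto a von Neumann algebra as a representation. -/
noncomputable def toRep : M.toStarSubalgebra →⋆ₐ[ℂ] (H →L[ℂ] H) :=
  N.toStarSubalgebra.subtype.comp (π : M.toStarSubalgebra →⋆ₐ[ℂ] N.toStarSubalgebra)

theorem toRep_apply (a : M.toStarSubalgebra) : toRep π a = (π a : H →L[ℂ] H) := rfl

/-- The support projection of a vector functional. -/
theorem exists_support (ξ : H) :
    ∃ s : M.toStarSubalgebra, IsStarProjection (s : K →L[ℂ] K) ∧ toRep π s ξ = ξ ∧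
      ∀ f : M.toStarSubalgebra, f * s = f → toRep π f ξ = 0 → f = 0 := by
  -- The support is the preimage under `π` of the projection onto the closed span of `N' ξ`: an
  -- element of `N` killing `ξ` kills all of `N' ξ`.
  set S : Set H := {k | ∃ b ∈ N.commutant, b ξ = k} with hSdef
  set U := (Submodule.span ℂ S).topologicalClosure with hU
  have hξ : ξ ∈ U := Submodule.le_topologicalClosure _
    (Submodule.subset_span ⟨1, one_mem _, rfl⟩)
  have hP : U.starProjection ∈ N := by
    refine starProjection_mem N U fun y hy k hk => map_mem_closure_span y ?_ hk
    rintro _ ⟨b, hb, rfl⟩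
    exact ⟨y * b, mul_mem hy hb, rfl⟩
  have hPP := isStarProjection_starProjection (U := U)
  set s : M.toStarSubalgebra := π.symm ⟨U.starProjection, hP⟩ with hs
  have hπs : π s = ⟨U.starProjection, hP⟩ := π.apply_symm_apply _
  refine ⟨s, ⟨?_, ?_⟩, ?_, ?_⟩
  · have : s * s = s := by
      apply EquivLike.injective π
      rw [map_mul, hπs]
      exact Subtype.ext hPP.isIdempotentElem.eq
    exact congr_arg Subtype.val this
  · have : star s = s := by
      apply EquivLike.injective π
      rw [map_star, hπs]
      exact Subtype.ext hPP.isSelfAdjoint.star_eq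
    exact congr_arg Subtype.val this
  · rw [toRep_apply, hπs]
    exact Submodule.starProjection_eq_self_iff.2 hξ
  · intro f hfs hfξ
    apply EquivLike.injective π
    rw [map_zero, ← hfs, map_mul, hπs]
    apply Subtype.ext
    ext k
    change (π f : H →L[ℂ] H) (U.starProjection k) = 0
    have hle : U ≤ LinearMap.ker (π f : H →L[ℂ] H).toLinearMap := by
      refine Submodule.topologicalClosure_minimal _ ?_ (π f : H →L[ℂ] H).isClosed_ker
      rw [Submodule.span_le]
      rintro _ ⟨b, hb, rfl⟩
      have : (π f : H →L[ℂ] H) (b ξ) = b ((π f : H →L[ℂ] H) ξ) :=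
        congr($((commute_of_mem (π f).2 hb).eq) ξ)
      change (π f : H →L[ℂ] H) (b ξ) = 0
      rw [this, ← toRep_apply, hfξ, map_zero]
    exact hle (Submodule.starProjection_apply_mem _ _)

/-- Every nonzero vector can be cut down to a nonzero vector whose vector functional is a vector
functional of the identity representation. -/
theorem exists_cutdown (ξ : H) (hξ : ξ ≠ 0) :
    ∃ p : M.toStarSubalgebra, toRep π p ξ ≠ 0 ∧
      ∃ η : K, ∀ b : M.toStarSubalgebra, ‖toRep π b (toRep π p ξ)‖ = ‖(b : K →L[ℂ] K) η‖ := by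
  obtain ⟨s, hs, hsξ, hsup⟩ := exists_support π ξ
  have hs0 : (s : K →L[ℂ] K) ≠ 0 := by
    intro h
    have : s = 0 := Subtype.ext h
    rw [this, map_zero] at hsξ
    exact hξ hsξ.symm
  obtain ⟨k, hk⟩ : ∃ k, (s : K →L[ℂ] K) k ≠ 0 := by
    by_contra! h
    exact hs0 (ContinuousLinearMap.ext h)
  -- Scaled to norm `‖ξ‖ + 1`, to exceed `‖ξ‖`.
  set η : K := (((‖ξ‖ + 1) / ‖(s : K →L[ℂ] K) k‖ : ℝ) : ℂ) • (s : K →L[ℂ] K) k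
  have hη : (s : K →L[ℂ] K) η = η := by
    rw [map_smul]
    congr 1
    exact congr($(hs.isIdempotentElem.eq) k)
  have hlt : ‖ξ‖ < ‖η‖ := by
    rw [norm_smul, Complex.norm_real, Real.norm_of_nonneg (by positivity),
      div_mul_cancel₀ _ (norm_ne_zero_iff.2 hk)]
    linarith
  obtain ⟨p, hp, hps, hp0, hdom⟩ := exists_dominating_projection (toRep π) s hs ξ η hsξ hη hlt
  refine ⟨p, fun h => hp0 (hsup p (Subtype.ext ?_) h), ?_⟩
  · exact (IsStarProjection.le_iff_mul_eq_left hp hs).1 hps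
  · exact exists_vectorFunctional_eq (toRep π) _ _ fun b =>
      norm_map_le_norm (toRep π) p hp ξ η hdom b

/-- The Hilbert space of a representation is a direct sum of cyclic subspaces whose cyclic vectors
induce vector functionals of the identity representation. -/
theorem exists_cyclic_decomposition :
    ∃ X : Set H, (∀ x ∈ X, x ≠ 0) ∧
      (∀ x ∈ X, ∃ η : K, ∀ b : M.toStarSubalgebra, ‖toRep π b x‖ = ‖(b : K →L[ℂ] K) η‖) ∧
      (∀ x ∈ X, ∀ y ∈ X, x ≠ y → ∀ b, inner ℂ (toRep π b x) y = 0) ∧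
      (Submodule.span ℂ {z | ∃ x ∈ X, ∃ b, toRep π b x = z}).topologicalClosure = ⊤ := by
  set Q : Set (Set H) := {X | (∀ x ∈ X, x ≠ 0) ∧
      (∀ x ∈ X, ∃ η : K, ∀ b : M.toStarSubalgebra, ‖toRep π b x‖ = ‖(b : K →L[ℂ] K) η‖) ∧
      (∀ x ∈ X, ∀ y ∈ X, x ≠ y → ∀ b, inner ℂ (toRep π b x) y = 0)} with hQ
  obtain ⟨X, hX⟩ := zorn_subset Q (by
    intro c hc hch
    refine ⟨⋃₀ c, ⟨?_, ?_, ?_⟩, fun s hs => Set.subset_sUnion_of_mem hs⟩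
    · rintro x ⟨s, hs, hx⟩; exact (hc hs).1 x hx
    · rintro x ⟨s, hs, hx⟩; exact (hc hs).2.1 x hx
    · rintro x ⟨s, hs, hx⟩ y ⟨t, ht, hy⟩
      rcases hch.total hs ht with h | h
      · exact (hc ht).2.2 x (h hx) y hy
      · exact (hc hs).2.2 x hx y (h hy))
  obtain ⟨h1, h2, h3⟩ := hX.prop
  refine ⟨X, h1, h2, h3, ?_⟩
  rw [Submodule.topologicalClosure_eq_top_iff, Submodule.eq_bot_iff]
  intro ξ hξ
  by_contra hξ0
  -- The cut-down of `ξ` remains orthogonal to all the cyclic subspaces, so it can be adjoined to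
  -- `X`. Maximality puts it in `X` already, which makes it orthogonal to itself.
  obtain ⟨p, hp0, η, hη⟩ := exists_cutdown π ξ hξ0
  have horth : ∀ x ∈ X, ∀ b, inner ℂ (toRep π b x) ξ = 0 := fun x hx b =>
    (Submodule.mem_orthogonal _ _).1 hξ _ (Submodule.subset_span ⟨x, hx, b, rfl⟩)
  have hadj : ∀ (b : M.toStarSubalgebra) (x y : H),
      inner ℂ (toRep π b x) y = inner ℂ x (toRep π (star b) y) := by
    intro b x y
    rw [map_star, ContinuousLinearMap.star_eq_adjoint, ContinuousLinearMap.adjoint_inner_right]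
  have horth' : ∀ x ∈ X, ∀ b, inner ℂ (toRep π b x) (toRep π p ξ) = 0 := by
    intro x hx b
    have := horth x hx (star p * b)
    rwa [map_mul, mul_apply_eq_comp, hadj, star_star] at this
  have hins : insert (toRep π p ξ) X ∈ Q := by
    refine ⟨?_, ?_, ?_⟩
    · rintro x (rfl | hx)
      exacts [hp0, h1 x hx]
    · rintro x (rfl | hx)
      exacts [⟨η, hη⟩, h2 x hx]
    · rintro x (rfl | hx) y (rfl | hy) hxy b
      · exact absurd rfl hxy
      · rw [hadj, ← inner_conj_symm, horth' y hy, map_zero]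
      · exact horth' x hx b
      · exact h3 x hx y hy hxy b
  have hmem : toRep π p ξ ∈ X := hX.le_of_ge hins (Set.subset_insert _ _) (Set.mem_insert _ _)
  have := horth' _ hmem 1
  rw [map_one, one_apply_eq_self, inner_self_eq_zero] at this
  exact hp0 this

end CyclicVectors
-- Isometries from equal Gram matrices
section GramMatrix

/-- Two families of vectors with the same Gram matrix, the first one total, are related by an
isometry. -/
theorem exists_linearIsometry_of_gram {T E F : Type*} [NormedAddCommGroup E]
    [InnerProductSpace ℂ E] [NormedAddCommGroup F] [InnerProductSpace ℂ F] [CompleteSpace F]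
    (e : T → E) (g : T → F) (h : ∀ i j, inner ℂ (e i) (e j) = inner ℂ (g i) (g j))
    (hd : Dense (Submodule.span ℂ (Set.range e) : Set E)) :
    ∃ W : E →ₗᵢ[ℂ] F, ∀ i, W (e i) = g i := by
  set e' := Finsupp.linearCombination ℂ e
  set g' := Finsupp.linearCombination ℂ g
  have hnorm : ∀ l, ‖g' l‖ = ‖e' l‖ := by
    intro l
    have : inner ℂ (g' l) (g' l) = inner ℂ (e' l) (e' l) := by
      simp only [e', g', Finsupp.linearCombination_apply, Finsupp.sum_inner, Finsupp.inner_sum,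
        inner_smul_left, inner_smul_right, h]
    rw [← sq_eq_sq₀ (norm_nonneg _) (norm_nonneg _)]
    have := congr_arg Complex.re this
    simpa [inner_self_eq_norm_sq_to_K, ← Complex.ofReal_pow] using this
  have hdense : DenseRange e' := by
    have : Set.range e' = (Submodule.span ℂ (Set.range e) : Set E) := by
      rw [← Finsupp.range_linearCombination]; rfl
    rw [DenseRange, this]
    exact hd
  set W₀ : E →L[ℂ] F := g'.extendOfNorm e'
  have hW : ∀ l, W₀ (e' l) = g' l :=
    LinearMap.extendOfNorm_eq hdense ⟨1, fun l => by rw [one_mul, hnorm]⟩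
  refine ⟨⟨W₀.toLinearMap, fun z => ?_⟩, fun i => ?_⟩
  · refine hdense.induction_on (p := fun z => ‖W₀ z‖ = ‖z‖) z
      (isClosed_eq (by fun_prop) (by fun_prop)) fun l => ?_
    rw [hW, hnorm]
  · have := hW (Finsupp.single i 1)
    simpa [e', g'] using this

end GramMatrix

/-! ### Hyperreflexivity constants of corners -/

section Corner

variable {E F : Type*} [NormedAddCommGroup E] [InnerProductSpace ℂ E] [CompleteSpace E]
  [NormedAddCommGroup F] [InnerProductSpace ℂ F] [CompleteSpace F]

/-- A test pair `ξ, η` for `V` compresses to `W* ξ, W* η`, orthogonal for `U` and of norm at most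
one. Normalizing can only enlarge the pairing; if a compression is zero, the pairing vanishes. -/
theorem rad_conj_le (U : Submodule ℂ (E →L[ℂ] E)) (V : Submodule ℂ (F →L[ℂ] F))
    (W : E →ₗᵢ[ℂ] F)
    (hUV : ∀ b ∈ U, W.toContinuousLinearMap ∘L b ∘L W.toContinuousLinearMap.adjoint ∈ V)
    (T : E →L[ℂ] E) :
    rad V (W.toContinuousLinearMap ∘L T ∘L W.toContinuousLinearMap.adjoint) ≤ rad U T := by
  set w := W.toContinuousLinearMap
  have hwn : ‖w.adjoint‖ ≤ 1 := by
    rw [LinearIsometryEquiv.norm_map]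
    exact W.norm_toContinuousLinearMap_le
  have hin : ∀ (b : E →L[ℂ] E) (ξ η : F), inner ℂ ((w ∘L b ∘L w.adjoint) ξ) η =
      inner ℂ (b (w.adjoint ξ)) (w.adjoint η) := by
    intro b ξ η
    rw [ContinuousLinearMap.adjoint_inner_right]; rfl
  refine iSup_le fun ξ => iSup_le fun η => iSup_le fun hξ => iSup_le fun hη => iSup_le fun h => ?_
  rw [hin]
  set x := w.adjoint ξ
  set y := w.adjoint η
  have hx1 : ‖x‖ ≤ 1 := by
    simpa [hξ] using (w.adjoint.le_of_opNorm_le hwn ξ)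
  have hy1 : ‖y‖ ≤ 1 := by
    simpa [hη] using (w.adjoint.le_of_opNorm_le hwn η)
  by_cases hx : x = 0
  · simp [hx]
  by_cases hy : y = 0
  · simp [hy]
  set x' : E := ((‖x‖⁻¹ : ℝ) : ℂ) • x
  set y' : E := ((‖y‖⁻¹ : ℝ) : ℂ) • y
  have hx' : ‖x'‖ = 1 := by
    rw [norm_smul, Complex.norm_real, norm_inv, norm_norm, inv_mul_cancel₀ (norm_ne_zero_iff.2 hx)]
  have hy' : ‖y'‖ = 1 := by
    rw [norm_smul, Complex.norm_real, norm_inv, norm_norm, inv_mul_cancel₀ (norm_ne_zero_iff.2 hy)]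
  have hsc : ∀ b : E →L[ℂ] E,
      inner ℂ (b x') y' = ((‖x‖⁻¹ * ‖y‖⁻¹ : ℝ) : ℂ) * inner ℂ (b x) y := by
    intro b
    rw [map_smul, inner_smul_left, inner_smul_right, Complex.conj_ofReal]
    push_cast; ring
  have horth : ∀ b ∈ U, inner ℂ (b x') y' = 0 := by
    intro b hb
    rw [hsc, ← hin, h _ (hUV b hb), mul_zero]
  have hle : ‖inner ℂ (T x) y‖ₑ ≤ ‖inner ℂ (T x') y'‖ₑ := by
    rw [enorm_le_iff_norm_le, hsc, norm_mul, Complex.norm_real, Real.norm_of_nonneg (by positivity)]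
    refine le_mul_of_one_le_left (norm_nonneg _) ?_
    exact one_le_mul_of_one_le_of_one_le
      ((one_le_inv₀ (norm_pos_iff.2 hx)).2 hx1) ((one_le_inv₀ (norm_pos_iff.2 hy)).2 hy1)
  refine hle.trans ?_
  exact le_iSup_of_le x' (le_iSup_of_le y' (le_iSup_of_le hx' (le_iSup_of_le hy'
    (le_iSup_of_le horth le_rfl))))

/-- The hyperreflexivity constant does not increase under passing to a corner. -/
theorem hyperConst_le_of_corner (U : Submodule ℂ (E →L[ℂ] E)) (V : Submodule ℂ (F →L[ℂ] F))
    (W : E →ₗᵢ[ℂ] F)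
    (hUV : ∀ b ∈ U, W.toContinuousLinearMap ∘L b ∘L W.toContinuousLinearMap.adjoint ∈ V)
    (hVU : ∀ X ∈ V, W.toContinuousLinearMap.adjoint ∘L X ∘L W.toContinuousLinearMap ∈ U) :
    hyperConst U ≤ hyperConst V := by
  set w := W.toContinuousLinearMap with hw
  have hww : ∀ z, w.adjoint (w z) = z := by
    have := (ContinuousLinearMap.norm_map_iff_adjoint_comp_self w).1 W.norm_map
    exact fun z => congr($this z)
  have hwn : ‖w‖ ≤ 1 := W.norm_toContinuousLinearMap_le
  have hwn' : ‖w.adjoint‖ ≤ 1 := by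
    rw [LinearIsometryEquiv.norm_map]
    exact hwn
  refine iSup₂_le fun T hT => ?_
  set T' := w ∘L T ∘L w.adjoint with hT'
  have hback : w.adjoint ∘L T' ∘L w = T := by
    ext z
    simp [hT', hww]
  have hT'V : T' ∉ V := fun h => hT (hback ▸ hVU _ h)
  -- Passing from `T` to `T' = W T W*` does not decrease the numerator, since `T - W* X W = W* (T' -
  -- X) W`, and does not increase the denominator.
  refine le_trans ?_ (le_iSup₂_of_le T' hT'V le_rfl)
  refine ENNReal.div_le_div (le_iInf₂ fun X hX => ?_) (rad_conj_le U V W hUV T)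
  refine iInf₂_le_of_le _ (hVU X hX) ?_
  rw [enorm_le_iff_norm_le]
  have : T - w.adjoint ∘L X ∘L w = w.adjoint ∘L (T' - X) ∘L w := by
    rw [ContinuousLinearMap.sub_comp, ContinuousLinearMap.comp_sub, hback]
  rw [this]
  calc _ ≤ ‖w.adjoint‖ * ‖(T' - X) ∘L w‖ := ContinuousLinearMap.opNorm_comp_le _ _
    _ ≤ ‖w.adjoint‖ * (‖T' - X‖ * ‖w‖) := by
      gcongr; exact ContinuousLinearMap.opNorm_comp_le _ _
    _ ≤ 1 * (‖T' - X‖ * 1) := by gcongr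
    _ = _ := by ring

end Corner

/-! ### Matrix spaces as commutants of amplifications -/

section Amplification

variable {K : Type*} [NormedAddCommGroup K] [InnerProductSpace ℂ K] {I : Type*}

/-- The amplification of an operator: the diagonal operator with constant diagonal. -/
noncomputable def diag (I : Type*) (a : K →L[ℂ] K) : Ampl I K →L[ℂ] Ampl I K :=
  lp.mapCLM 2 (fun _ => a) (norm_nonneg a) fun _ => le_rfl

theorem diag_apply (a : K →L[ℂ] K) (f : Ampl I K) (i : I) : diag I a f i = a (f i) := rfl

theorem diag_single [DecidableEq I] (a : K →L[ℂ] K) (i : I) (k : K) :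
    diag I a (lp.single 2 i k) = lp.single 2 i (a k) := by
  ext j
  rw [diag_apply, lp.single_apply, lp.single_apply]
  by_cases h : j = i
  · subst h; simp
  · simp [Pi.single_eq_of_ne h]

theorem inner_diag_left [CompleteSpace K] (a : K →L[ℂ] K) (f g : Ampl I K) :
    inner ℂ (diag I a f) g = inner ℂ f (diag I (star a) g) := by
  rw [lp.inner_eq_tsum, lp.inner_eq_tsum]
  refine tsum_congr fun i => ?_
  rw [diag_apply, diag_apply, ContinuousLinearMap.star_eq_adjoint,
    ContinuousLinearMap.adjoint_inner_right]

open scoped Classical in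
theorem entry_apply (T : Ampl I K →L[ℂ] Ampl I K) (i j : I) (k : K) :
    entry T i j k = T (lp.single 2 j k) i := rfl

/-- The matrices over a von Neumann algebra are the operators commuting with the amplification of
its commutant. -/
theorem mem_matrixSpace_iff [CompleteSpace K] (A : VonNeumannAlgebra K)
    (T : Ampl I K →L[ℂ] Ampl I K) :
    T ∈ matrixSpace I (opSpace A) ↔ ∀ b ∈ A.commutant, ∀ f, T (diag I b f) = diag I b (T f) := by
  classical
  constructor
  · intro hT b hb f
    have : T ∘L diag I b = diag I b ∘L T := by
      refine lp.ext_continuousLinearMap (by norm_num) fun j => ?_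
      ext k i
      change T (diag I b (lp.single 2 j k)) i = diag I b (T (lp.single 2 j k)) i
      have h1 : entry T i j ∈ A := hT i j
      have h2 : entry T i j (b k) = b (entry T i j k) :=
        congr($((commute_of_mem h1 hb).eq) k)
      rw [diag_single, diag_apply]
      rw [entry_apply, entry_apply] at h2
      convert h2
    exact congr($this f)
  · intro h i j
    refine mem_of_commute A fun b hb => ?_
    ext k
    change entry T i j (b k) = b (entry T i j k)
    have h1 := congr($(h b hb (lp.single 2 j k)) i)
    rw [diag_single, diag_apply] at h1
    rw [entry_apply, entry_apply]
    convert h1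

end Amplification

/-! ### Counting orthogonal vectors -/

section Cardinality

variable {H : Type*} [NormedAddCommGroup H] [InnerProductSpace ℂ H]

/-- Each `x` meets some basis vector, and by Bessel each basis vector meets only countably many `x`.
Hence `X` embeds in `ι × ℕ`, thus in `I × I`, and `I × I ≃ I` as `I` is infinite. -/
theorem exists_embedding_of_orthogonal {I : Type w} [Infinite I] {ι : Type x}
    (e : HilbertBasis ι ℂ H)
    (hcard : Cardinal.lift.{w} (Cardinal.mk ι) ≤ Cardinal.lift.{x} (Cardinal.mk I))
    (X : Set H) (h0 : ∀ x ∈ X, x ≠ 0) (horth : ∀ x ∈ X, ∀ y ∈ X, x ≠ y → inner ℂ x y = 0) :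
    Nonempty (I × X ↪ I) := by
  have hex : ∀ x : X, ∃ i, inner ℂ (x : H) (e i) ≠ 0 := by
    intro x
    by_contra! h
    refine h0 x x.2 ?_
    have : (x : H) ∈ (Submodule.span ℂ (Set.range e))ᗮ := by
      rw [Submodule.mem_orthogonal']
      intro u hu
      induction hu using Submodule.span_induction with
      | mem z hz => obtain ⟨i, rfl⟩ := hz; exact h i
      | zero => simp
      | add a b _ _ ha hb => rw [inner_add_right, ha, hb, add_zero]
      | smul c a _ ha => rw [inner_smul_right, ha, mul_zero]
    rw [← Submodule.orthogonal_closure, e.dense_span] at this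
    simpa using this
  choose i hi using hex
  have hcount : ∀ j, {x : X | inner ℂ (x : H) (e j) ≠ 0}.Countable := by
    intro j
    have hon : Orthonormal ℂ fun x : X => ((‖(x : H)‖⁻¹ : ℝ) : ℂ) • (x : H) := by
      constructor
      · intro x
        rw [norm_smul, Complex.norm_real, norm_inv, norm_norm,
          inv_mul_cancel₀ (norm_ne_zero_iff.2 (h0 x x.2))]
      · intro x y hxy
        rw [inner_smul_left, inner_smul_right, horth x x.2 y y.2 (fun h => hxy (Subtype.ext h))]
        simp
    refine (hon.inner_products_summable (e j)).countable_support.mono fun x hx => ?_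
    simp only [Function.mem_support, inner_smul_left]
    have : inner ℂ (x : H) (e j) ≠ 0 := hx
    simp [this, h0 x x.2]
  have henc : ∀ j, ∃ φ : X → ℕ, Set.InjOn φ {x : X | inner ℂ (x : H) (e j) ≠ 0} :=
    fun j => (Set.countable_iff_exists_injOn).1 (hcount j)
  choose φ hφ using henc
  let f₁ : X ↪ ι × ℕ := ⟨fun x => (i x, φ (i x) x), by
    intro x y hxy
    simp only [Prod.mk.injEq] at hxy
    obtain ⟨h1, h2⟩ := hxy
    rw [← h1] at h2
    refine hφ (i x) (hi x) ?_ h2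
    change inner ℂ (y : H) (e (i x)) ≠ 0
    rw [h1]; exact hi y⟩
  obtain ⟨f₂⟩ := Cardinal.lift_mk_le'.1 hcard
  have hII : Nonempty (I × I ≃ I) := by
    rw [← Cardinal.eq, Cardinal.mk_prod, Cardinal.lift_id,
      Cardinal.mul_eq_self (Cardinal.aleph0_le_mk I)]
  obtain ⟨m⟩ := hII
  exact ⟨((Function.Embedding.refl I).prodMap
    ((f₁.trans (f₂.prodMap (Infinite.natEmbedding I))).trans m.toEmbedding)).trans m.toEmbedding⟩

end Cardinality

/-! ### The intertwining isometry and the comparison of constants -/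

section Main

variable {K : Type*} [NormedAddCommGroup K] [InnerProductSpace ℂ K] [CompleteSpace K]
  {H : Type*} [NormedAddCommGroup H] [InnerProductSpace ℂ H] [CompleteSpace H]

/-- Polarization, with the norm identity taken at `a ± b` and `a ± i b`. -/
theorem inner_eq_of_norm_eq {M : VonNeumannAlgebra K}
    (ρ : M.toStarSubalgebra →⋆ₐ[ℂ] (H →L[ℂ] H)) {ξ : H} {η : K}
    (h : ∀ b : M.toStarSubalgebra, ‖ρ b ξ‖ = ‖(b : K →L[ℂ] K) η‖) (a b : M.toStarSubalgebra) :
    inner ℂ (ρ a ξ) (ρ b ξ) = inner ℂ ((a : K →L[ℂ] K) η) ((b : K →L[ℂ] K) η) := by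
  have h1 := h (a + b)
  have h2 := h (a - b)
  have h3 := h (a - Complex.I • b)
  have h4 := h (a + Complex.I • b)
  rw [map_add, add_apply] at h1
  rw [map_sub, sub_apply] at h2
  rw [map_sub, map_smul, sub_apply, smul_apply] at h3
  rw [map_add, map_smul, add_apply, smul_apply] at h4
  rw [inner_eq_sum_norm_sq_div_four, inner_eq_sum_norm_sq_div_four]
  simp only [RCLike.I_to_complex]
  rw [h1, h2, h3, h4]
  rfl

/-- An isomorphism of von Neumann algebras is, after amplification, the restriction to an
invariant subspace of an amplification of the identity representation. -/
theorem exists_intertwining_isometry {M : VonNeumannAlgebra K} {N : VonNeumannAlgebra H}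
    (π : M.toStarSubalgebra ≃⋆ₐ[ℂ] N.toStarSubalgebra) {I : Type w} [Infinite I] {ι : Type x}
    (e : HilbertBasis ι ℂ H)
    (hcard : Cardinal.lift.{w} (Cardinal.mk ι) ≤ Cardinal.lift.{x} (Cardinal.mk I)) :
    ∃ W : Ampl I H →ₗᵢ[ℂ] Ampl I K, ∀ (b : M.toStarSubalgebra) (f : Ampl I H),
      W (diag I (π b : H →L[ℂ] H) f) = diag I (b : K →L[ℂ] K) (W f) := by
  classical
  obtain ⟨X, h0, hη, horth, htop⟩ := exists_cyclic_decomposition π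
  obtain ⟨φ⟩ := exists_embedding_of_orthogonal e hcard X h0 fun x hx y hy hxy => by
    simpa using horth x hx y hy hxy 1
  choose! η hη using hη
  let u : M.toStarSubalgebra × I × X → Ampl I H :=
    fun t => lp.single 2 t.2.1 (toRep π t.1 (t.2.2 : H))
  -- The vectors `η x` need not generate orthogonal subspaces of `K`; the injection `φ` gives each
  -- pair `(i, x)` its own coordinate, which restores orthogonality.
  let g : M.toStarSubalgebra × I × X → Ampl I K :=
    fun t => lp.single 2 (φ t.2) ((t.1 : K →L[ℂ] K) (η t.2.2))
  have hgram : ∀ s t, inner ℂ (u s) (u t) = inner ℂ (g s) (g t) := by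
    rintro ⟨b, i, x⟩ ⟨c, j, y⟩
    simp only [u, g]
    rw [lp.inner_single_left, lp.inner_single_left, lp.single_apply, lp.single_apply]
    by_cases hij : i = j
    · subst hij
      by_cases hxy : x = y
      · subst hxy
        simp only [Pi.single_eq_same]
        exact inner_eq_of_norm_eq (toRep π) (hη x x.2) b c
      · have hne : φ (i, x) ≠ φ (i, y) := fun h => hxy (congr_arg Prod.snd (φ.injective h))
        rw [Pi.single_eq_same, Pi.single_eq_of_ne hne, inner_zero_right]
        have := horth x x.2 y y.2 (fun h => hxy (Subtype.ext h)) (star c * b)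
        rwa [map_mul, map_star, mul_apply_eq_comp, ContinuousLinearMap.star_eq_adjoint,
          ContinuousLinearMap.adjoint_inner_left] at this
    · have hne : φ (i, x) ≠ φ (j, y) := fun h => hij (congr_arg Prod.fst (φ.injective h))
      rw [Pi.single_eq_of_ne hij, Pi.single_eq_of_ne hne, inner_zero_right, inner_zero_right]
  have hdense : Dense (Submodule.span ℂ (Set.range u) : Set (Ampl I H)) := by
    rw [Submodule.dense_iff_topologicalClosure_eq_top, Submodule.topologicalClosure_eq_top_iff,
      Submodule.eq_bot_iff]
    intro f hf
    ext i
    have hfi : f i ∈ (Submodule.span ℂ {z | ∃ x ∈ X, ∃ b, toRep π b x = z})ᗮ := by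
      rw [Submodule.mem_orthogonal]
      intro z hz
      induction hz using Submodule.span_induction with
      | mem z hz =>
        obtain ⟨x, hx, b, rfl⟩ := hz
        have := (Submodule.mem_orthogonal _ _).1 hf _
          (Submodule.subset_span ⟨(b, i, ⟨x, hx⟩), rfl⟩)
        rwa [lp.inner_single_left] at this
      | zero => simp
      | add a b _ _ ha hb => rw [inner_add_left, ha, hb, add_zero]
      | smul c a _ ha => rw [inner_smul_left, ha, mul_zero]
    rw [← Submodule.orthogonal_closure, htop] at hfi
    simpa using hfi
  obtain ⟨W, hW⟩ := exists_linearIsometry_of_gram u g hgram hdense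
  refine ⟨W, fun b f => ?_⟩
  have : W.toContinuousLinearMap ∘L diag I (π b : H →L[ℂ] H) =
      diag I (b : K →L[ℂ] K) ∘L W.toContinuousLinearMap := by
    refine ContinuousLinearMap.ext_on hdense ?_
    rintro _ ⟨⟨c, i, x⟩, rfl⟩
    change W (diag I (π b : H →L[ℂ] H) (u (c, i, x))) = diag I (b : K →L[ℂ] K) (W (u (c, i, x)))
    have h1 : diag I (π b : H →L[ℂ] H) (u (c, i, x)) = u (b * c, i, x) := by
      simp only [u]
      rw [diag_single, map_mul, toRep_apply π b]; rfl
    rw [h1, hW, hW]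
    simp only [g]
    rw [diag_single]; rfl
  exact congr($this f)

theorem hyperConst_matrixSpace_le (A : VonNeumannAlgebra K) (B : VonNeumannAlgebra H)
    (π : A.commutant.toStarSubalgebra ≃⋆ₐ[ℂ] B.commutant.toStarSubalgebra)
    {I : Type w} [Infinite I] {ι : Type x} (e : HilbertBasis ι ℂ H)
    (hcard : Cardinal.lift.{w} (Cardinal.mk ι) ≤ Cardinal.lift.{x} (Cardinal.mk I)) :
    hyperConst (matrixSpace I (opSpace B)) ≤ hyperConst (matrixSpace I (opSpace A)) := by
  obtain ⟨W, hW⟩ := exists_intertwining_isometry π e hcard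
  set w := W.toContinuousLinearMap
  have hw : ∀ (b : A.commutant.toStarSubalgebra) (f : Ampl I H),
      w (diag I (π b : H →L[ℂ] H) f) = diag I (b : K →L[ℂ] K) (w f) := hW
  -- The adjoint intertwines in the other direction: take adjoints in the relation for `star b`.
  have hw' : ∀ (b : A.commutant.toStarSubalgebra) (f : Ampl I K),
      w.adjoint (diag I (b : K →L[ℂ] K) f) = diag I (π b : H →L[ℂ] H) (w.adjoint f) := by
    intro b f
    refine ext_inner_right ℂ fun g => ?_
    have h1 : ((star b : A.commutant.toStarSubalgebra) : K →L[ℂ] K) = star (b : K →L[ℂ] K) := rfl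
    have h2 : (π (star b) : H →L[ℂ] H) = star (π b : H →L[ℂ] H) := by rw [map_star]; rfl
    rw [ContinuousLinearMap.adjoint_inner_left, inner_diag_left, inner_diag_left, ← h1, ← hw, h2,
      ContinuousLinearMap.adjoint_inner_left]
  refine hyperConst_le_of_corner _ _ W ?_ ?_
  · intro T hT
    rw [mem_matrixSpace_iff] at hT ⊢
    intro b hb f
    have h1 := hw' ⟨b, hb⟩ f
    have h2 := hw ⟨b, hb⟩ (T (w.adjoint f))
    change w (T (w.adjoint (diag I b f))) = diag I b (w (T (w.adjoint f)))
    rw [h1, hT _ (π ⟨b, hb⟩).2, h2]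
  · intro T hT
    rw [mem_matrixSpace_iff] at hT ⊢
    intro c hc f
    -- Surjectivity of `π` is essential here: `W* T W` must commute with the amplification of all of
    -- `B'`.
    obtain ⟨b, hb⟩ := EquivLike.surjective π ⟨c, hc⟩
    have h1 := hw b f
    have h2 := hw' b (T (w f))
    rw [hb] at h1 h2
    change w.adjoint (T (w (diag I c f))) = diag I c (w.adjoint (T (w f)))
    rw [h1, hT _ b.2, h2]

/-- A separable Hilbert space has a countable Hilbert basis. -/
theorem exists_countable_hilbertBasis [TopologicalSpace.SeparableSpace H] :
    ∃ (s : Set H) (_ : HilbertBasis s ℂ H), s.Countable := by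
  obtain ⟨s, e, he⟩ := exists_hilbertBasis ℂ H
  refine ⟨s, e, ?_⟩
  have hon : Orthonormal ℂ ((↑) : s → H) := he ▸ e.orthonormal
  have hdisj : s.PairwiseDisjoint fun x => Metric.ball x (1 / 2 : ℝ) := by
    intro x hx y hy hxy
    -- Distinct orthonormal vectors are at distance `√2`, more than the sum `1` of the radii;
    -- separability allows only countably many disjoint balls.
    refine Metric.ball_disjoint_ball ?_
    have h1 : inner ℂ x y = 0 := hon.2 (i := ⟨x, hx⟩) (j := ⟨y, hy⟩) (by simpa using hxy)
    have h2 : ‖x‖ = 1 := hon.1 ⟨x, hx⟩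
    have h3 : ‖y‖ = 1 := hon.1 ⟨y, hy⟩
    have h4 : ‖x - y‖ * ‖x - y‖ = 2 := by
      rw [norm_sub_mul_self (𝕜 := ℂ), h1, h2, h3]
      norm_num
    rw [dist_eq_norm]
    nlinarith [norm_nonneg (x - y)]
  exact hdisj.countable_of_isOpen (fun _ _ => Metric.isOpen_ball)
    fun x _ => ⟨x, Metric.mem_ball_self (by norm_num)⟩

theorem hyperConst_matrixSpace_nat_le [TopologicalSpace.SeparableSpace H]
    (A : VonNeumannAlgebra K) (B : VonNeumannAlgebra H)
    (π : A.commutant.toStarSubalgebra ≃⋆ₐ[ℂ] B.commutant.toStarSubalgebra) :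
    hyperConst (matrixSpace ℕ (opSpace B)) ≤ hyperConst (matrixSpace ℕ (opSpace A)) := by
  obtain ⟨s, e, hs⟩ := exists_countable_hilbertBasis (H := H)
  refine hyperConst_matrixSpace_le A B π e ?_
  have := Cardinal.le_aleph0_iff_set_countable.2 hs
  simpa using this

end Main
end Hyperreflexivity

theorem theorem4p7
    {K : Type u} [NormedAddCommGroup K] [InnerProductSpace ℂ K] [CompleteSpace K]
    {H : Type v} [NormedAddCommGroup H] [InnerProductSpace ℂ H] [CompleteSpace H]
    (A : VonNeumannAlgebra K) (B : VonNeumannAlgebra H)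
    (π : A.commutant.toStarSubalgebra ≃⋆ₐ[ℂ] B.commutant.toStarSubalgebra) :
    (∀ (I : Type w) [Infinite I] (ι : Type x) (_ : HilbertBasis ι ℂ H),
      Cardinal.lift.{w} (Cardinal.mk ι) ≤ Cardinal.lift.{x} (Cardinal.mk I) →
        Hyperreflexivity.hyperConst
            (Hyperreflexivity.matrixSpace I (Hyperreflexivity.opSpace B)) ≤
          Hyperreflexivity.hyperConst
            (Hyperreflexivity.matrixSpace I (Hyperreflexivity.opSpace A))) ∧
    (TopologicalSpace.SeparableSpace K → TopologicalSpace.SeparableSpace H →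
      Hyperreflexivity.hyperConst
          (Hyperreflexivity.matrixSpace ℕ (Hyperreflexivity.opSpace B)) =
        Hyperreflexivity.hyperConst
          (Hyperreflexivity.matrixSpace ℕ (Hyperreflexivity.opSpace A))) := by
  refine ⟨fun I _ ι e hcard => Hyperreflexivity.hyperConst_matrixSpace_le A B π e hcard,
    fun _ _ => le_antisymm ?_ ?_⟩
  · exact Hyperreflexivity.hyperConst_matrixSpace_nat_le A B π
  · exact Hyperreflexivity.hyperConst_matrixSpace_nat_le B A π.symm
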